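/- Let $W$ be a path-continuous, intrinsically stationary Gaussian random field on $\mathbb{R}^d$ with mean $\mathbb{E}W(t)=0$, variance $\sigma^2(t)=\operatorname{Var}(W(t))$ and variogram $\gamma(h)=\tfrac12\,\mathbb{E}(W(h)-W(0))^2$. (Intrinsically stationary means: for every $h\in\mathbb{R}^d$ the mean and the covariances of the increment field $x\mapsto W(x+h)-W(x)$ are translation invariant.) Let $W_i$, $i\in\mathbb{N}$, be independent copies of $W$, let $Q$ be any probability measure on $\mathbb{R}^d$, and let $\sum_{i\in\mathbb{N}}\delta_{(X_i,H_i)}$ be a Poisson point process on $\mathbb{R}\times\mathbb{R}^d$ with intensity measure $e^{-x}\,dx\,Q(dh)$ such that the sequence $((X_i,H_i))_{i\in\mathbb{N}}$ is independent of $(W_i)_{i\in\mathbb{N}}$. Put $$\tilde Z(t)=\max_{i\in\mathbb{N}}\Big(X_i+W_i(t-H_i)-\frac{\sigma^2(t-H_i)}2\Big),\qquad t\in\mathbb{R}^d .$$ Then $\tilde Z$ is a Brown–Resnick process with variogram $\gamma$. That is, for each $t$ the maximum is almost surely attained, and $\tilde Z\overset{d}{=}Z$ (equality of all finite-dimensional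 distributions) for every Brown–Resnick process $$Z(t)=\max_{i\in\mathbb{N}}\Big(X_i'+W_i'(t)-\frac{\sigma'^2(t)}2\Big),\qquad t\in\mathbb{R}^d,$$ with variogram $\gamma$. Here the $W_i'$ are independent copies of a path-continuous, centred, intrinsically stationary Gaussian field $W'$ with the same variogram $\gamma$ and with variance $\sigma'^2(t)=\operatorname{Var}(W'(t))$ (for instance $W'=W$), and $\sum_i\delta_{X_i'}$ is a Poisson point process on $\mathbb{R}$ with intensity measure $e^{-x}\,dx$ such that the sequence $(X_i')_{i\in\mathbb{N}}$ is independent of $(W_i')_{i\in\mathbb{N}}$; also in the definition of $Z(t)$ the maximum is, for each $t$, almost surely attained. In particular, $Q$ may be the uniform distribution on finitely many points or on a bounded interval. -/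

import Mathlib

open MeasureTheory ProbabilityTheory
open scoped ENNReal NNReal

namespace BrownResnick

/-- The space `ℝ^d`. -/
abbrev Rd (d : ℕ) : Type := EuclideanSpace ℝ (Fin d)

/-- The path space `C(ℝ^d)` carries the σ-algebra generated by the evaluations `f ↦ f t`
(equivalently, by the finite-dimensional cylinder sets). -/
instance instMeasurableSpacePath (d : ℕ) : MeasurableSpace C(Rd d, ℝ) :=
  MeasurableSpace.comap (fun (f : C(Rd d, ℝ)) (t : Rd d) => f t) MeasurableSpace.pi

section Fields

variable {d : ℕ} {Ω : Type*} [MeasurableSpace Ω]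

/-- Weak stationarity of a square integrable field: mean and covariance are translation
invariant. -/
structure IsWeaklyStationary (Y : Rd d → Ω → ℝ) (P : Measure Ω) : Prop where
  memLp : ∀ t, MemLp (Y t) 2 P
  mean_eq : ∀ s t, ∫ ω, Y s ω ∂P = ∫ ω, Y t ω ∂P
  cov_eq : ∀ x s t, covariance (Y (x + s)) (Y s) P = covariance (Y (x + t)) (Y t) P

/-- Intrinsic stationarity: for every lag `h` the increment field `x ↦ Y (x + h) - Y x` is weakly
stationary. -/
def IsIntrinsicallyStationary (Y : Rd d → Ω → ℝ) (P : Measure Ω) : Prop :=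
  ∀ h : Rd d, IsWeaklyStationary (fun x ω => Y (x + h) ω - Y x ω) P

/-- The (semi-)variogram `γ(h) = E (Y(h) - Y(0))² / 2`. -/
noncomputable def variogram (Y : Rd d → Ω → ℝ) (P : Measure Ω) (h : Rd d) : ℝ :=
  (1 / 2) * ∫ ω, (Y h ω - Y 0 ω) ^ 2 ∂P

/-- `W` is a path-continuous, centred, intrinsically stationary Gaussian field on `ℝ^d` with
variogram `γ`. -/
structure IsGenerator (γ : Rd d → ℝ) (W : Ω → C(Rd d, ℝ)) (P : Measure Ω) : Prop where
  measurable : Measurable W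
  gaussian : IsGaussianProcess (fun (t : Rd d) (ω : Ω) => W ω t) P
  centred : ∀ t, ∫ ω, W ω t ∂P = 0
  intrinsic : IsIntrinsicallyStationary (fun (t : Rd d) (ω : Ω) => W ω t) P
  variogram_eq : ∀ h, variogram (fun (t : Rd d) (ω : Ω) => W ω t) P h = γ h

/-- The variance function `σ²(t) = Var (W t)`. -/
noncomputable def varianceFun (W : Ω → C(Rd d, ℝ)) (P : Measure Ω) (t : Rd d) : ℝ :=
  variance (fun ω => W ω t) P

/-- The fields `V 0, V 1, …` (on `(Ω, P)`) are independent copies of the field `W`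
(on `(Ω₀, P₀)`). -/
structure IsIIDCopies {Ω₀ : Type*} [MeasurableSpace Ω₀] (V : ℕ → Ω → C(Rd d, ℝ)) (P : Measure Ω)
    (W : Ω₀ → C(Rd d, ℝ)) (P₀ : Measure Ω₀) : Prop where
  measurable : ∀ i, Measurable (V i)
  identDistrib : ∀ i, IdentDistrib (V i) W P P₀
  indep : iIndepFun V P

end Fields

section Poisson

/-- The Poisson distribution with parameter `r ∈ [0, ∞]`, as a law on `[0, ∞]`; for `r = ∞` it is
the point mass at `∞`. -/
noncomputable def poissonLaw (r : ℝ≥0∞) : Measure ℝ≥0∞ :=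
  if r = ∞ then Measure.dirac ∞ else (poissonMeasure r.toNNReal).map (fun n : ℕ => (n : ℝ≥0∞))

variable {Ω S : Type*} [MeasurableSpace Ω] [MeasurableSpace S]

/-- The random counting measure `∑ᵢ δ_{ξᵢ}`. -/
noncomputable def countingMeasure (ξ : ℕ → Ω → S) (ω : Ω) : Measure S :=
  Measure.sum fun i => Measure.dirac (ξ i ω)

/-- `∑ᵢ δ_{ξᵢ}` is a Poisson point process on `S` with intensity measure `μ`. -/
structure IsPoissonPointProcess (ξ : ℕ → Ω → S) (μ : Measure S) (P : Measure Ω) : Prop where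
  measurable : ∀ i, Measurable (ξ i)
  indep : ∀ (n : ℕ) (A : Fin n → Set S), (∀ k, MeasurableSet (A k)) →
    Pairwise (fun k l => Disjoint (A k) (A l)) →
    iIndepFun (fun (k : Fin n) (ω : Ω) => countingMeasure ξ ω (A k)) P
  poisson : ∀ A : Set S, MeasurableSet A →
    HasLaw (fun ω => countingMeasure ξ ω A) (poissonLaw (μ A)) P

/-- The measure `e^{-x} dx` on `ℝ`. -/
noncomputable def expIntensity : Measure ℝ :=
  (volume : Measure ℝ).withDensity fun x => ENNReal.ofReal (Real.exp (-x))

end Poisson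

section Maxima

variable {d : ℕ} {Ω : Type*}

/-- The `i`-th path `X_i + W_i(t) - σ²(t)/2`. -/
noncomputable def path (s : Rd d → ℝ) (X : ℕ → Ω → ℝ) (W : ℕ → Ω → C(Rd d, ℝ))
    (i : ℕ) (t : Rd d) (ω : Ω) : ℝ :=
  X i ω + W i ω t - s t / 2

/-- The `i`-th randomly shifted path `X_i + W_i(t - H_i) - σ²(t - H_i)/2`. -/
noncomputable def shiftedPath (s : Rd d → ℝ) (X : ℕ → Ω → ℝ) (H : ℕ → Ω → Rd d)
    (W : ℕ → Ω → C(Rd d, ℝ)) (i : ℕ) (t : Rd d) (ω : Ω) : ℝ :=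
  X i ω + W i ω (t - H i ω) - s (t - H i ω) / 2

/-- The field `Z(t) = sup_i (X_i + W_i(t) - σ²(t)/2)`. -/
noncomputable def field (s : Rd d → ℝ) (X : ℕ → Ω → ℝ) (W : ℕ → Ω → C(Rd d, ℝ))
    (t : Rd d) (ω : Ω) : ℝ :=
  ⨆ i, path s X W i t ω

/-- The field `Z̃(t) = sup_i (X_i + W_i(t - H_i) - σ²(t - H_i)/2)`. -/
noncomputable def shiftedField (s : Rd d → ℝ) (X : ℕ → Ω → ℝ) (H : ℕ → Ω → Rd d)
    (W : ℕ → Ω → C(Rd d, ℝ)) (t : Rd d) (ω : Ω) : ℝ :=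
  ⨆ i, shiftedPath s X H W i t ω

end Maxima

end BrownResnick

/-! A maximum over an independently marked Poisson process stays below given levels at finitely many
points exactly when no marked path exceeds them. This void probability is `exp(-m)`, with `m` the
mean number of exceeding paths (`IsPoissonPointProcess.measure_forall_notMem`, from the Laplace
functional), so the numbers `m` determine the finite-dimensional laws.

Integrating out `e^{-x} dx` turns `m` into the mean of an exceedance mass of the vector `L = Y - Var
Y / 2`, and this mass is multiplied by `e^c` when `c` is added to all coordinates. Pulling out the
coordinate `L k₀` expresses `m` through the law of the increments `L k - L k₀` under the density
`exp (L k₀)`. The Laplace transform of that law is the mean of `exp (∑ v k * L k)` with `∑ v = 1`,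
and on this hyperplane only the variances of `Y j - Y k` matter (`sum_mul_sub_half_variance`).

Hence `m` depends only on `γ` and the differences of the points (`IsGenerator.generatorMass_eq`). A
shift by a fixed `h` preserves these differences, so averaging over `Q` changes nothing, and neither
does exchanging `W` for `W'`. At a single point `m` is finite, so the maximum is attained by
Borel–Cantelli. -/

namespace BrownResnick

/-! ### The exponential `e^{-r}` with values at `∞`. -/

/-- The function `r ↦ e^{-r}` on `[0, ∞]`. -/
noncomputable def expNeg (r : ℝ≥0∞) : ℝ≥0∞ := (EReal.exp r)⁻¹

@[simp] lemma expNeg_zero : expNeg 0 = 1 := by simp [expNeg]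

@[simp] lemma expNeg_top : expNeg ∞ = 0 := by simp [expNeg]

lemma expNeg_add (a b : ℝ≥0∞) : expNeg (a + b) = expNeg a * expNeg b := by
  have h (x : ℝ≥0∞) : EReal.exp x ≠ 0 := by simp
  rw [expNeg, EReal.coe_ennreal_add, EReal.exp_add, ENNReal.mul_inv (.inl (h a)) (.inr (h b))]
  rfl

lemma expNeg_sum {ι : Type*} (s : Finset ι) (f : ι → ℝ≥0∞) :
    expNeg (∑ i ∈ s, f i) = ∏ i ∈ s, expNeg (f i) := by
  classical
  induction s using Finset.induction_on with
  | empty => simp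
  | insert a s ha ih => rw [Finset.sum_insert ha, Finset.prod_insert ha, expNeg_add, ih]

lemma expNeg_mul_natCast (c : ℝ≥0∞) (n : ℕ) : expNeg (c * n) = expNeg c ^ n := by
  simpa [mul_comm] using expNeg_sum (Finset.range n) fun _ => c

lemma continuous_expNeg : Continuous expNeg :=
  continuous_inv.comp (ENNReal.continuous_exp.comp continuous_coe_ennreal_ereal)

lemma measurable_expNeg : Measurable expNeg := continuous_expNeg.measurable

lemma expNeg_le_one (r : ℝ≥0∞) : expNeg r ≤ 1 := by
  simp [expNeg, ENNReal.inv_le_one, EReal.coe_ennreal_nonneg]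

lemma expNeg_lt_one {r : ℝ≥0∞} (hr : r ≠ 0) : expNeg r < 1 := by
  rw [expNeg, ENNReal.inv_lt_one, EReal.one_lt_exp_iff]
  exact_mod_cast pos_iff_ne_zero.2 hr

lemma antitone_expNeg : Antitone expNeg := fun a b h => by
  simpa [expNeg] using h

lemma expNeg_ofReal {r : ℝ} (hr : 0 ≤ r) :
    expNeg (ENNReal.ofReal r) = ENNReal.ofReal (Real.exp (-r)) := by
  rw [expNeg, EReal.coe_ennreal_ofReal, max_eq_left hr, EReal.exp_coe, Real.exp_neg,
    ENNReal.ofReal_inv_of_pos (Real.exp_pos r)]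

/-- The inverse `g ↦ -log g` of `expNeg` on `[0, 1]`. -/
noncomputable def negLog (g : ℝ≥0∞) : ℝ≥0∞ := (ENNReal.log g⁻¹).toENNReal

lemma measurable_negLog : Measurable negLog := by
  unfold negLog
  fun_prop

lemma expNeg_negLog {g : ℝ≥0∞} (hg : g ≤ 1) : expNeg (negLog g) = g := by
  rw [expNeg, negLog, EReal.coe_toENNReal, ENNReal.exp_log, inv_inv]
  simpa using hg

lemma expNeg_tsum (f : ℕ → ℝ≥0∞) : expNeg (∑' i, f i) = ∏' i, expNeg (f i) := by
  refine (HasProd.tprod_eq ?_).symm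
  have := (continuous_expNeg.tendsto _).comp (ENNReal.summable (f := f)).hasSum
  simpa [HasProd, Function.comp_def, expNeg_sum] using this

/-! ### Laplace transform and mean of the Poisson law. -/

section PoissonLaw

lemma lintegral_poissonMeasure (r : ℝ≥0) (f : ℕ → ℝ≥0∞) :
    ∫⁻ n, f n ∂poissonMeasure r
      = ∑' n : ℕ, f n * ENNReal.ofReal (Real.exp (-r) * r ^ n / n.factorial) := by
  rw [lintegral_countable']
  simp [poissonMeasure_singleton]

lemma lintegral_expNeg_poissonLaw (c r : ℝ≥0∞) :
    ∫⁻ x, expNeg (c * x) ∂poissonLaw r = expNeg ((1 - expNeg c) * r) := by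
  have hm : Measurable fun x : ℝ≥0∞ => expNeg (c * x) := measurable_expNeg.comp (by fun_prop)
  -- For infinite intensity the count is `∞`, and both sides are `0` unless `c = 0`.
  by_cases hr : r = ∞
  · rw [poissonLaw, if_pos hr, lintegral_dirac' _ hm, hr]
    by_cases hc : c = 0
    · simp [hc]
    · have : 1 - expNeg c ≠ 0 := (tsub_pos_of_lt (expNeg_lt_one hc)).ne'
      simp [ENNReal.mul_top, hc, this]
  · lift r to ℝ≥0 using hr
    rw [poissonLaw, if_neg ENNReal.coe_ne_top, lintegral_map hm (by fun_prop)]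
    simp only [expNeg_mul_natCast, ENNReal.toNNReal_coe]
    rw [lintegral_poissonMeasure]
    have hq1 := expNeg_le_one c
    obtain ⟨q, hq⟩ : ∃ q : ℝ≥0, expNeg c = q :=
      ⟨_, (ENNReal.coe_toNNReal (ne_top_of_le_ne_top ENNReal.one_ne_top hq1)).symm⟩
    rw [hq] at hq1 ⊢
    have hq1' : (q : ℝ) ≤ 1 := by exact_mod_cast hq1
    have hterm (n : ℕ) :
        (q : ℝ≥0∞) ^ n * ENNReal.ofReal (Real.exp (-r) * r ^ n / n.factorial)
        = ENNReal.ofReal (Real.exp (-r) * ((r * q : ℝ) ^ n / n.factorial)) := by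
      rw [← ENNReal.ofReal_coe_nnreal, ← ENNReal.ofReal_pow q.coe_nonneg,
        ← ENNReal.ofReal_mul (by positivity)]
      congr 1
      rw [mul_pow]
      ring
    simp_rw [hterm]
    have hs : HasSum (fun n : ℕ => Real.exp (-r) * ((r * q : ℝ) ^ n / n.factorial))
        (Real.exp (-r) * Real.exp (r * q)) := by
      rw [Real.exp_eq_exp_ℝ]
      exact (NormedSpace.expSeries_div_hasSum_exp (r * q : ℝ)).mul_left _
    rw [← ENNReal.ofReal_tsum_of_nonneg (fun n => by positivity) hs.summable, hs.tsum_eq,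
      ← Real.exp_add]
    have : (1 - (q : ℝ≥0∞)) * r = ENNReal.ofReal ((1 - q) * r) := by
      rw [ENNReal.ofReal_mul (by linarith), ENNReal.ofReal_sub _ q.coe_nonneg]
      simp
    rw [this, expNeg_ofReal (mul_nonneg (by linarith) r.coe_nonneg)]
    congr 2
    ring

lemma lintegral_id_poissonLaw (r : ℝ≥0∞) : ∫⁻ x, x ∂poissonLaw r = r := by
  by_cases hr : r = ∞
  · rw [poissonLaw, if_pos hr, lintegral_dirac' _ (by fun_prop), hr]
  · lift r to ℝ≥0 using hr
    rw [poissonLaw, if_neg ENNReal.coe_ne_top, lintegral_map (by fun_prop) (by fun_prop)]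
    simp only [ENNReal.toNNReal_coe]
    -- The term `n = 0` vanishes; in the others `n / n! = 1 / (n - 1)!` leaves `r` times the Poisson
    -- weights.
    rw [lintegral_poissonMeasure, tsum_eq_zero_add' ENNReal.summable]
    have hterm (n : ℕ) : ((n + 1 : ℕ) : ℝ≥0∞)
          * ENNReal.ofReal (Real.exp (-r) * r ^ (n + 1) / (n + 1).factorial)
        = r * ENNReal.ofReal (Real.exp (-r) * r ^ n / n.factorial) := by
      rw [← ENNReal.ofReal_natCast, ← ENNReal.ofReal_coe_nnreal,
        ← ENNReal.ofReal_mul (by positivity), ← ENNReal.ofReal_mul (by positivity)]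
      congr 1
      rw [Nat.factorial_succ]
      push_cast
      field_simp
      ring
    simp_rw [hterm]
    rw [ENNReal.tsum_mul_left, ← ENNReal.ofReal_tsum_of_nonneg (fun n => by positivity)
      (hasSum_one_poissonMeasure r).summable, (hasSum_one_poissonMeasure r).tsum_eq]
    simp

end PoissonLaw

/-! ### Laplace functional and marking of Poisson processes. -/

section PointProcess

variable {Ω S M : Type*} [MeasurableSpace Ω] [MeasurableSpace S] [MeasurableSpace M]
  {ξ : ℕ → Ω → S} {μ : Measure S} {P : Measure Ω}

omit [MeasurableSpace Ω] in
lemma lintegral_countingMeasure (ξ : ℕ → Ω → S) (ω : Ω) {f : S → ℝ≥0∞} (hf : Measurable f) :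
    ∫⁻ s, f s ∂countingMeasure ξ ω = ∑' i, f (ξ i ω) := by
  rw [countingMeasure, lintegral_sum_measure]
  simp [lintegral_dirac' _ hf]

lemma measurable_lintegral_countingMeasure (hξ : ∀ i, Measurable (ξ i)) {f : S → ℝ≥0∞}
    (hf : Measurable f) : Measurable fun ω => ∫⁻ s, f s ∂countingMeasure ξ ω := by
  simp_rw [lintegral_countingMeasure ξ _ hf]
  exact Measurable.tsum fun i => hf.comp (hξ i)

lemma measurable_countingMeasure_apply (hξ : ∀ i, Measurable (ξ i)) {A : Set S}
    (hA : MeasurableSet A) : Measurable fun ω => countingMeasure ξ ω A := by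
  simpa [lintegral_indicator_one hA] using
    measurable_lintegral_countingMeasure hξ (measurable_one.indicator hA)

/-- The level sets of a simple function are disjoint, so their counts are independent Poisson
variables and the Laplace transform factorizes. -/
lemma IsPoissonPointProcess.lintegral_expNeg_simpleFunc (h : IsPoissonPointProcess ξ μ P)
    (f : SimpleFunc S ℝ≥0∞) :
    ∫⁻ ω, expNeg (∫⁻ s, f s ∂countingMeasure ξ ω) ∂P = expNeg (∫⁻ s, (1 - expNeg (f s)) ∂μ) := by
  let e := f.range.equivFin
  let c : Fin f.range.card → ℝ≥0∞ := fun k => (e.symm k : ℝ≥0∞)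
  let A : Fin f.range.card → Set S := fun k => f ⁻¹' {c k}
  have hA (k) : MeasurableSet (A k) := f.measurableSet_preimage _
  have hdisj : Pairwise fun k l => Disjoint (A k) (A l) := fun k l hkl =>
    Disjoint.preimage _ <| Set.disjoint_singleton.2 fun hc =>
      hkl <| e.symm.injective <| Subtype.ext hc
  have hsum (g : ℝ≥0∞ → ℝ≥0∞) : ∑ x ∈ f.range, g x = ∑ k, g (c k) := by
    rw [← Finset.sum_coe_sort]
    exact (Equiv.sum_comp e.symm fun x : f.range => g x).symm
  have hleft (ω) : expNeg (∫⁻ s, f s ∂countingMeasure ξ ω)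
      = ∏ k, expNeg (c k * countingMeasure ξ ω (A k)) := by
    rw [SimpleFunc.lintegral_eq_lintegral, SimpleFunc.lintegral,
      hsum fun x => x * countingMeasure ξ ω (f ⁻¹' {x}), expNeg_sum]
  have hright : ∫⁻ s, (1 - expNeg (f s)) ∂μ = ∑ k, (1 - expNeg (c k)) * μ (A k) := by
    have := SimpleFunc.map_lintegral (μ := μ) (fun x => 1 - expNeg x) f
    rw [← hsum fun x => (1 - expNeg x) * μ (f ⁻¹' {x}), ← this,
      ← SimpleFunc.lintegral_eq_lintegral]
    rfl
  simp_rw [hleft]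
  have hm (k) : Measurable fun x : ℝ≥0∞ => expNeg (c k * x) :=
    measurable_expNeg.comp (by fun_prop)
  rw [lintegral_prod_eq_prod_lintegral_of_indepFun Finset.univ
    (fun k ω => expNeg (c k * countingMeasure ξ ω (A k)))
    ((h.indep _ A hA hdisj).comp (fun k x => expNeg (c k * x)) hm)
    fun k => (hm k).comp (measurable_countingMeasure_apply h.measurable (hA k)), hright, expNeg_sum]
  refine Finset.prod_congr rfl fun k _ => ?_
  rw [← lintegral_expNeg_poissonLaw, ← (h.poisson _ (hA k)).map_eq,
    lintegral_map (hm k) (measurable_countingMeasure_apply h.measurable (hA k))]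

/-- The Laplace functional of a Poisson point process. -/
lemma IsPoissonPointProcess.lintegral_expNeg [IsProbabilityMeasure P]
    (h : IsPoissonPointProcess ξ μ P) {f : S → ℝ≥0∞} (hf : Measurable f) :
    ∫⁻ ω, expNeg (∫⁻ s, f s ∂countingMeasure ξ ω) ∂P = expNeg (∫⁻ s, (1 - expNeg (f s)) ∂μ) := by
  let g (n : ℕ) := SimpleFunc.eapprox f n
  have hmono (s : S) : Monotone fun n => g n s := fun m n hmn => SimpleFunc.monotone_eapprox f hmn s
  have hlim (s : S) : Filter.Tendsto (fun n => g n s) Filter.atTop (nhds (f s)) := by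
    rw [← SimpleFunc.iSup_eapprox_apply hf s]
    exact tendsto_atTop_iSup (hmono s)
  have h1 : Filter.Tendsto (fun n => ∫⁻ ω, expNeg (∫⁻ s, g n s ∂countingMeasure ξ ω) ∂P)
      Filter.atTop (nhds (∫⁻ ω, expNeg (∫⁻ s, f s ∂countingMeasure ξ ω) ∂P)) := by
    refine tendsto_lintegral_of_dominated_convergence 1
      (fun n => measurable_expNeg.comp
        (measurable_lintegral_countingMeasure h.measurable (g n).measurable))
      (fun n => .of_forall fun ω => expNeg_le_one _) (by simp) (.of_forall fun ω => ?_)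
    exact (continuous_expNeg.tendsto _).comp <|
      lintegral_tendsto_of_tendsto_of_monotone (fun n => (g n).measurable.aemeasurable)
        (.of_forall hmono) (.of_forall hlim)
  have h2 : Filter.Tendsto (fun n => expNeg (∫⁻ s, (1 - expNeg (g n s)) ∂μ))
      Filter.atTop (nhds (expNeg (∫⁻ s, (1 - expNeg (f s)) ∂μ))) := by
    refine (continuous_expNeg.tendsto _).comp <|
      lintegral_tendsto_of_tendsto_of_monotone
        (fun n => (measurable_const.sub (measurable_expNeg.comp (g n).measurable)).aemeasurable)
        (.of_forall fun s m n hmn => tsub_le_tsub_left (antitone_expNeg (hmono s hmn)) _)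
        (.of_forall fun s => ?_)
    exact ENNReal.Tendsto.sub tendsto_const_nhds ((continuous_expNeg.tendsto _).comp (hlim s))
      (.inl ENNReal.one_ne_top)
  refine tendsto_nhds_unique h1 ?_
  simpa only [h.lintegral_expNeg_simpleFunc] using h2

/-- The intensity measure is the mean of the counting measure. -/
lemma IsPoissonPointProcess.sum_map_eq (h : IsPoissonPointProcess ξ μ P) :
    (Measure.sum fun i => P.map (ξ i)) = μ := by
  ext A hA
  rw [Measure.sum_apply _ hA, ← lintegral_id_poissonLaw (μ A), ← (h.poisson A hA).map_eq,
    lintegral_map (by fun_prop) (measurable_countingMeasure_apply h.measurable hA)]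
  have (ω : Ω) : countingMeasure ξ ω A = ∑' i, A.indicator 1 (ξ i ω) := by
    rw [← lintegral_indicator_one hA, lintegral_countingMeasure _ _ (measurable_one.indicator hA)]
  simp only [this]
  have hm (i : ℕ) : Measurable fun ω => A.indicator (1 : S → ℝ≥0∞) (ξ i ω) :=
    (measurable_one.indicator hA).comp (h.measurable i)
  rw [lintegral_tsum fun i => (hm i).aemeasurable]
  refine tsum_congr fun i => ?_
  rw [← lintegral_map (measurable_one.indicator hA) (h.measurable i), lintegral_indicator_one hA]

variable {V : ℕ → Ω → M} {κ : Measure M}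

/-- The law of the points and marks of an independently marked sequence. -/
lemma map_prodMk_eq_prod_infinitePi [IsProbabilityMeasure P] [IsProbabilityMeasure κ]
    (hξ : ∀ i, Measurable (ξ i)) (hV : ∀ i, Measurable (V i)) (hκ : ∀ i, P.map (V i) = κ)
    (hVind : iIndepFun V P) (hind : IndepFun (fun ω i => ξ i ω) (fun ω i => V i ω) P) :
    P.map (fun ω => ((fun i => ξ i ω), fun i => V i ω))
      = (P.map fun ω i => ξ i ω).prod (Measure.infinitePi fun _ : ℕ => κ) := by
  rw [(indepFun_iff_map_prod_eq_prod_map_map (measurable_pi_lambda _ hξ).aemeasurable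
    (measurable_pi_lambda _ hV).aemeasurable).1 hind,
    (iIndepFun_iff_map_fun_eq_infinitePi_map hV).1 hVind]
  simp [hκ]

/-- The probability that an independently marked Poisson process avoids a set. -/
lemma IsPoissonPointProcess.measure_forall_notMem [IsProbabilityMeasure P] [IsProbabilityMeasure κ]
    (h : IsPoissonPointProcess ξ μ P) (hV : ∀ i, Measurable (V i)) (hκ : ∀ i, P.map (V i) = κ)
    (hVind : iIndepFun V P) (hind : IndepFun (fun ω i => ξ i ω) (fun ω i => V i ω) P)
    {E : Set (S × M)} (hE : MeasurableSet E) :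
    P {ω | ∀ i, (ξ i ω, V i ω) ∉ E} = expNeg (∫⁻ s, κ (Prod.mk s ⁻¹' E) ∂μ) := by
  have hξ := h.measurable
  have hsec : Measurable fun s => κ (Prod.mk s ⁻¹' E) := measurable_measure_prodMk_left hE
  have hsecc (s : S) : κ (Prod.mk s ⁻¹' E)ᶜ = 1 - κ (Prod.mk s ⁻¹' E) :=
    prob_compl_eq_one_sub (measurable_prodMk_left hE)
  have hm : Measurable fun ω => ((fun i => ξ i ω), fun i => V i ω) :=
    (measurable_pi_lambda _ hξ).prodMk (measurable_pi_lambda _ hV)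
  let B : Set ((ℕ → S) × (ℕ → M)) := ⋂ i, {p | (p.1 i, p.2 i) ∈ Eᶜ}
  have hB : MeasurableSet B := MeasurableSet.iInter fun i =>
    (show Measurable fun p : (ℕ → S) × (ℕ → M) => (p.1 i, p.2 i) by fun_prop) hE.compl
  have hset : {ω | ∀ i, (ξ i ω, V i ω) ∉ E}
      = (fun ω => ((fun i => ξ i ω), fun i => V i ω)) ⁻¹' B := by
    ext ω
    simp [B]
  rw [hset, ← Measure.map_apply hm hB, map_prodMk_eq_prod_infinitePi hξ hV hκ hVind hind,
    Measure.prod_apply hB, lintegral_map (measurable_measure_prodMk_left hB)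
      (measurable_pi_lambda _ hξ)]
  -- Given the points, all marks avoid `E` with probability `∏ (1 - κ(E_s))`; this `f` writes the
  -- product as `e^{-∑ f}`. The value `∞` occurs where the section has full mass.
  let f : S → ℝ≥0∞ := fun s => negLog (1 - κ (Prod.mk s ⁻¹' E))
  have hf : Measurable f := measurable_negLog.comp (measurable_const.sub hsec)
  have hexp (s : S) : expNeg (f s) = 1 - κ (Prod.mk s ⁻¹' E) := expNeg_negLog tsub_le_self
  have hinner (x : ℕ → S) : (Measure.infinitePi fun _ : ℕ => κ) (Prod.mk x ⁻¹' B)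
      = expNeg (∑' i, f (x i)) := by
    have : Prod.mk x ⁻¹' B = Set.univ.pi fun i => (Prod.mk (x i) ⁻¹' E)ᶜ := by
      ext m
      simp [B]
    rw [this, Measure.infinitePi_pi_univ _ fun i => (measurable_prodMk_left hE).compl, expNeg_tsum]
    simp_rw [hsecc, hexp]
  simp_rw [hinner, ← lintegral_countingMeasure ξ _ hf]
  rw [h.lintegral_expNeg hf]
  congr 1
  refine lintegral_congr fun s => ?_
  rw [hexp, ENNReal.sub_sub_cancel ENNReal.one_ne_top prob_le_one]

/-- The mean number of points of an independently marked Poisson process in a set. -/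
lemma IsPoissonPointProcess.tsum_measure_mem [IsProbabilityMeasure P]
    (h : IsPoissonPointProcess ξ μ P) (hV : ∀ i, Measurable (V i)) (hκ : ∀ i, P.map (V i) = κ)
    (hind : IndepFun (fun ω i => ξ i ω) (fun ω i => V i ω) P)
    {E : Set (S × M)} (hE : MeasurableSet E) :
    ∑' i, P {ω | (ξ i ω, V i ω) ∈ E} = ∫⁻ s, κ (Prod.mk s ⁻¹' E) ∂μ := by
  have hprob (i : ℕ) : IsProbabilityMeasure (P.map (V i)) :=
    Measure.isProbabilityMeasure_map (hV i).aemeasurable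
  have : IsProbabilityMeasure κ := hκ 0 ▸ hprob 0
  -- Replacing `μ` by the sum of the laws of the `ξ i` reduces the claim to the product law of each
  -- pair `(ξ i, V i)`.
  rw [← h.sum_map_eq, lintegral_sum_measure]
  refine tsum_congr fun i => ?_
  have hi : IndepFun (ξ i) (V i) P :=
    hind.comp (measurable_pi_apply i) (measurable_pi_apply i)
  rw [← hκ i, ← Measure.prod_apply hE, ← (indepFun_iff_map_prod_eq_prod_map_map
    (h.measurable i).aemeasurable (hV i).aemeasurable).1 hi,
    Measure.map_apply ((h.measurable i).prodMk (hV i)) hE]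
  rfl

end PointProcess

/-! ### Uniqueness of measures with finite Laplace transforms. -/

section MomentGenerating

/-- Finite measures on `ℝ` with the same everywhere finite moment generating function agree. -/
lemma measure_ext_of_mgf_eq {μ ν : Measure ℝ} [IsFiniteMeasure μ] [IsFiniteMeasure ν]
    (hint : ∀ t : ℝ, Integrable (fun x => Real.exp (t * x)) μ)
    (h : mgf id μ = mgf id ν) : μ = ν := by
  have h0 : μ = 0 ↔ ν = 0 := by
    have h1 := congrFun h 0
    simp only [mgf_zero'] at h1
    rw [← Measure.measure_univ_eq_zero, ← Measure.measure_univ_eq_zero (μ := ν),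
      ← measureReal_eq_zero_iff, h1, measureReal_eq_zero_iff]
  have hset : integrableExpSet id μ = Set.univ := Set.eq_univ_of_forall hint
  -- The strip on which the complex moment generating function is analytic is all of `ℂ`, so
  -- agreement on the real line extends to it.
  refine Measure.ext_of_complexMGF_id_eq (funext fun z => ?_)
  exact eqOn_complexMGF_of_mgf' h h0 (by simp [hset])

/-- Finite measures on `ℝ^ι` with the same everywhere finite Laplace transform agree. -/
lemma measure_pi_ext_of_lintegral_exp_eq {ι : Type*} [Fintype ι] {μ ν : Measure (ι → ℝ)}
    [IsFiniteMeasure μ] [IsFiniteMeasure ν]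
    (hfin : ∀ u : ι → ℝ, ∫⁻ x, ENNReal.ofReal (Real.exp (∑ k, u k * x k)) ∂μ ≠ ∞)
    (h : ∀ u : ι → ℝ, ∫⁻ x, ENNReal.ofReal (Real.exp (∑ k, u k * x k)) ∂μ
      = ∫⁻ x, ENNReal.ofReal (Real.exp (∑ k, u k * x k)) ∂ν) : μ = ν := by
  classical
  -- It suffices to compare the images under each linear functional `L`; their moment generating
  -- functions at `t` are the given transforms at `u k = t * L (Pi.single k 1)`.
  refine Measure.ext_of_charFunDual (funext fun L => ?_)
  have hL (t : ℝ) (x : ι → ℝ) : t * L x = ∑ k, (t * L (Pi.single k 1)) * x k := by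
    conv_lhs => rw [← Finset.univ_sum_single x, map_sum, Finset.mul_sum]
    refine Finset.sum_congr rfl fun k _ => ?_
    have : Pi.single k (x k) = x k • (Pi.single k 1 : ι → ℝ) := by
      rw [← Pi.single_smul]; simp
    rw [this, map_smul, smul_eq_mul]
    ring
  have hLint (t : ℝ) (ρ : Measure (ι → ℝ)) : ∫⁻ x, ENNReal.ofReal (Real.exp (t * L x)) ∂ρ
      = ∫⁻ x, ENNReal.ofReal (Real.exp (∑ k, (t * L (Pi.single k 1)) * x k)) ∂ρ :=
    lintegral_congr fun x => by rw [hL t x]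
  have hm (t : ℝ) : Measurable fun x : ι → ℝ => Real.exp (t * L x) := by fun_prop
  have hint (t : ℝ) : Integrable (fun x => Real.exp (t * L x)) μ := by
    refine ⟨(hm t).aestronglyMeasurable, ?_⟩
    rw [hasFiniteIntegral_iff_ofReal (.of_forall fun x => (Real.exp_pos _).le)]
    rw [hLint t]
    exact (hfin _).lt_top
  rw [charFunDual_eq_charFun_map_one, charFunDual_eq_charFun_map_one]
  congr 1
  refine measure_ext_of_mgf_eq (fun t => ?_) (funext fun t => ?_)
  · rw [integrable_map_measure (by fun_prop) (by fun_prop)]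
    exact hint t
  · rw [mgf_id_map (by fun_prop), mgf_id_map (by fun_prop)]
    unfold mgf
    rw [integral_eq_lintegral_of_nonneg_ae (.of_forall fun x => (Real.exp_pos _).le)
        (hm t).aestronglyMeasurable,
      integral_eq_lintegral_of_nonneg_ae (.of_forall fun x => (Real.exp_pos _).le)
        (hm t).aestronglyMeasurable]
    rw [hLint t, hLint t, h]

end MomentGenerating

/-! ### Exponential moments of log-normalized Gaussian vectors. -/

section Gaussian

variable {Ω ι : Type*} [MeasurableSpace Ω] {P : Measure Ω}

lemma lintegral_exp_of_hasGaussianLaw {X : Ω → ℝ} (hX : HasGaussianLaw X P)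
    (h0 : ∫ ω, X ω ∂P = 0) (c : ℝ) :
    ∫⁻ ω, ENNReal.ofReal (Real.exp (X ω - c)) ∂P
      = ENNReal.ofReal (Real.exp (Var[X; P] / 2 - c)) := by
  have hmap := hX.map_eq_gaussianReal
  have := hX.isProbabilityMeasure
  have hint : Integrable (fun ω => Real.exp (X ω)) P := by
    have h1 := integrable_exp_mul_gaussianReal (μ := P[X]) (v := Var[X; P].toNNReal) 1
    rw [← hmap, integrable_map_measure (by fun_prop) hX.aemeasurable] at h1
    simpa [Function.comp_def] using h1
  have hmgf := mgf_gaussianReal hmap 1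
  simp only [mgf, one_mul, h0, mul_one, zero_add, one_pow,
    Real.coe_toNNReal _ (variance_nonneg X P)] at hmgf
  simp_rw [Real.exp_sub]
  rw [← ofReal_integral_eq_lintegral_ofReal (hint.div_const _) (.of_forall fun ω => by positivity),
    integral_div, hmgf]

variable [Fintype ι]

/-- Expand `Var (Y j - Y k)`: because `∑ v = 1`, each of the two pure variance double sums collapses
to `∑ v k * Var (Y k)`, while the covariances sum to the variance of the linear combination. -/
lemma sum_mul_sub_half_variance {Y : ι → Ω → ℝ} [IsFiniteMeasure P] (hY : ∀ k, MemLp (Y k) 2 P)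
    {v : ι → ℝ} (hv : ∑ k, v k = 1) :
    Var[fun ω => ∑ k, v k * Y k ω; P] / 2 - ∑ k, v k * (Var[Y k; P] / 2)
      = -(1 / 4) * ∑ j, ∑ k, v j * v k * Var[Y j - Y k; P] := by
  have h1 : Var[fun ω => ∑ k, v k * Y k ω; P] = ∑ j, ∑ k, v j * v k * cov[Y j, Y k; P] := by
    have hm (k) : MemLp (fun ω => v k * Y k ω) 2 P := (hY k).const_mul _
    rw [← covariance_self (memLp_finsetSum _ fun k _ => hm k).aemeasurable,
      covariance_fun_sum_fun_sum hm hm]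
    simp_rw [covariance_const_mul_left, covariance_const_mul_right, mul_assoc]
  have h2 (j k) : Var[Y j - Y k; P] = Var[Y j; P] - 2 * cov[Y j, Y k; P] + Var[Y k; P] :=
    variance_sub (hY j) (hY k)
  have h3 : ∑ j, ∑ k, v j * v k * Var[Y j; P] = ∑ k, v k * Var[Y k; P] := by
    refine Finset.sum_congr rfl fun j _ => ?_
    rw [← Finset.sum_mul, ← Finset.mul_sum, hv, mul_one]
  have h4 : ∑ j, ∑ k, v j * v k * Var[Y k; P] = ∑ k, v k * Var[Y k; P] := by
    rw [Finset.sum_comm, ← h3]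
    exact Finset.sum_congr rfl fun j _ => Finset.sum_congr rfl fun k _ => by ring
  have h5 : ∑ j, ∑ k, v j * v k * Var[Y j - Y k; P]
      = 2 * (∑ k, v k * Var[Y k; P]) - 2 * ∑ j, ∑ k, v j * v k * cov[Y j, Y k; P] := by
    have : (2 : ℝ) * (∑ k, v k * Var[Y k; P])
        = (∑ j, ∑ k, v j * v k * Var[Y j; P]) + ∑ j, ∑ k, v j * v k * Var[Y k; P] := by
      rw [h3, h4]; ring
    rw [this]
    simp_rw [h2, Finset.mul_sum, ← Finset.sum_add_distrib, ← Finset.sum_sub_distrib]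
    exact Finset.sum_congr rfl fun j _ => Finset.sum_congr rfl fun k _ => by ring
  have h6 : ∑ k, v k * (Var[Y k; P] / 2) = (∑ k, v k * Var[Y k; P]) / 2 := by
    rw [Finset.sum_div]
    exact Finset.sum_congr rfl fun k _ => by ring
  rw [h1, h5, h6]
  ring

/-- The moment generating function of a log-normalized centred Gaussian vector on the affine
hyperplane `∑ v = 1` only depends on the variances of the increments. -/
lemma lintegral_exp_sum_sub_half_variance {Y : ι → Ω → ℝ}
    (hG : HasGaussianLaw (fun ω => (Y · ω)) P) (h0 : ∀ k, ∫ ω, Y k ω ∂P = 0)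
    {v : ι → ℝ} (hv : ∑ k, v k = 1) :
    ∫⁻ ω, ENNReal.ofReal (Real.exp (∑ k, v k * (Y k ω - Var[Y k; P] / 2))) ∂P
      = ENNReal.ofReal (Real.exp (-(1 / 4) * ∑ j, ∑ k, v j * v k * Var[Y j - Y k; P])) := by
  have := hG.isProbabilityMeasure
  have hX : HasGaussianLaw (fun ω => ∑ k, v k * Y k ω) P := by
    convert! hG.map_fun
      (∑ k, v k • ContinuousLinearMap.proj (R := ℝ) (φ := fun _ : ι => ℝ) k) using 2
    simp
  have hX0 : ∫ ω, ∑ k, v k * Y k ω ∂P = 0 := by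
    rw [integral_finsetSum _ fun k _ => (hG.eval k).integrable.const_mul _]
    simp [integral_const_mul, h0]
  rw [← sum_mul_sub_half_variance (fun k => (hG.eval k).memLp_two) hv,
    ← lintegral_exp_of_hasGaussianLaw hX hX0]
  simp_rw [mul_sub, Finset.sum_sub_distrib]

end Gaussian

/-! ### Exceedance sets under the measure `e^{-x} dx`. -/

section Exceedance

lemma expIntensity_Ioi (c : ℝ) :
    expIntensity (Set.Ioi c) = ENNReal.ofReal (Real.exp (-c)) := by
  rw [expIntensity, withDensity_apply _ measurableSet_Ioi,
    ← ofReal_integral_eq_lintegral_ofReal (integrableOn_exp_neg_Ioi c)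
      (.of_forall fun x => (Real.exp_pos _).le), integral_exp_neg_Ioi]

instance : SFinite expIntensity := by unfold expIntensity; infer_instance

lemma expIntensity_preimage_add_const {A : Set ℝ} (hA : MeasurableSet A) (c : ℝ) :
    expIntensity ((fun x => x + c) ⁻¹' A) = ENNReal.ofReal (Real.exp c) * expIntensity A := by
  have hpre : MeasurableSet ((fun x => x + c) ⁻¹' A) := measurable_add_const c hA
  rw [expIntensity, withDensity_apply _ hpre, withDensity_apply _ hA, ← lintegral_const_mul _
    (by fun_prop), ← lintegral_indicator hpre, ← lintegral_indicator hA]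
  refine Eq.trans ?_ (lintegral_add_right_eq_self _ c)
  refine lintegral_congr fun x => ?_
  by_cases hx : x + c ∈ A
  · rw [Set.indicator_of_mem (show x ∈ (fun x => x + c) ⁻¹' A from hx), Set.indicator_of_mem hx,
      ← ENNReal.ofReal_mul (Real.exp_pos _).le, ← Real.exp_add]
    congr 2
    ring
  · rw [Set.indicator_of_notMem (show x ∉ (fun x => x + c) ⁻¹' A from hx),
      Set.indicator_of_notMem hx]

variable {ι : Type*}

/-- The levels `x` at which `x + z` exceeds `y` in some coordinate. -/
def exceedance (y z : ι → ℝ) : Set ℝ := {x | ∃ k, y k < x + z k}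

variable [Countable ι]

lemma measurableSet_exceedance (y : ι → ℝ) :
    MeasurableSet {p : ℝ × (ι → ℝ) | ∃ k, y k < p.1 + p.2 k} := by
  have : {p : ℝ × (ι → ℝ) | ∃ k, y k < p.1 + p.2 k} = ⋃ k, {p | y k < p.1 + p.2 k} := by
    ext; simp
  rw [this]
  exact MeasurableSet.iUnion fun k => measurableSet_lt (by fun_prop) (by fun_prop)

lemma measurable_expIntensity_exceedance (y : ι → ℝ) :
    Measurable fun z : ι → ℝ => expIntensity (exceedance y z) :=
  measurable_measure_prodMk_right (measurableSet_exceedance y)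

/-- Adding `c` to all coordinates translates the exceedance set, and `e^{-x} = e^c e^{-(x + c)}`.
This homogeneity is what permits the change of measure below. -/
lemma expIntensity_exceedance_add_const (y z : ι → ℝ) (c : ℝ) :
    expIntensity (exceedance y fun k => z k + c)
      = ENNReal.ofReal (Real.exp c) * expIntensity (exceedance y z) := by
  rw [← expIntensity_preimage_add_const (A := exceedance y z)
    (measurable_prodMk_right (measurableSet_exceedance y))]
  congr 1
  ext x
  simp only [exceedance, Set.mem_ofPred_eq, Set.mem_preimage]
  exact exists_congr fun k => by rw [add_right_comm, add_assoc]

end Exceedance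

/-! ### Tilting: the mean exceedance mass depends only on increments. -/

section ExceedanceMass

variable {ι Ω Ω' : Type*} [Fintype ι] [MeasurableSpace Ω] [MeasurableSpace Ω']
  {P : Measure Ω} {P' : Measure Ω'}

/-- The vector `Y - Var Y / 2`. -/
noncomputable def logNormalized (Y : ι → Ω → ℝ) (P : Measure Ω) (ω : Ω) (k : ι) : ℝ :=
  Y k ω - Var[Y k; P] / 2

omit [Fintype ι] in
lemma measurable_logNormalized {Y : ι → Ω → ℝ} (hY : ∀ k, Measurable (Y k)) :
    Measurable (logNormalized Y P) :=
  measurable_pi_lambda _ fun k => (hY k).sub_const _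

/-- The law of the increments from `k₀` of a log-normalized vector, tilted by its `k₀`-th
exponential. -/
noncomputable def tiltedIncrements (Y : ι → Ω → ℝ) (P : Measure Ω) (k₀ : ι) : Measure (ι → ℝ) :=
  (P.withDensity fun ω => ENNReal.ofReal (Real.exp (logNormalized Y P ω k₀))).map
    fun ω k => logNormalized Y P ω k - logNormalized Y P ω k₀

omit [Fintype ι] in
lemma lintegral_tiltedIncrements {Y : ι → Ω → ℝ} (hY : ∀ k, Measurable (Y k)) (k₀ : ι)
    {f : (ι → ℝ) → ℝ≥0∞} (hf : Measurable f) :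
    ∫⁻ x, f x ∂tiltedIncrements Y P k₀
      = ∫⁻ ω, ENNReal.ofReal (Real.exp (logNormalized Y P ω k₀))
          * f (fun k => logNormalized Y P ω k - logNormalized Y P ω k₀) ∂P := by
  have hm (k : ι) : Measurable fun ω => logNormalized Y P ω k :=
    measurable_pi_iff.1 (measurable_logNormalized hY) k
  have hD : Measurable fun ω k => logNormalized Y P ω k - logNormalized Y P ω k₀ :=
    measurable_pi_lambda _ fun k => (hm k).sub (hm k₀)
  rw [tiltedIncrements, lintegral_map hf hD, lintegral_withDensity_eq_lintegral_mul _
    (hm k₀).exp.ennreal_ofReal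
    (show Measurable fun ω => f fun k => logNormalized Y P ω k - logNormalized Y P ω k₀ from
      hf.comp hD)]
  rfl

/-- The vector `u` with its `k₀`-th coordinate changed so that the coordinates sum up to `1`. -/
noncomputable def affineExtension (k₀ : ι) (u : ι → ℝ) (k : ι) : ℝ :=
  u k + (1 - ∑ j, u j) * Set.indicator {k₀} 1 k

/-- The density contributes `L k₀` to the exponent, and `L k₀ + ∑ u k * (L k - L k₀) = ∑ v k * L k`,
where the coefficients `v = affineExtension k₀ u` sum to `1`. -/
lemma lintegral_exp_tiltedIncrements {Y : ι → Ω → ℝ} (hY : ∀ k, Measurable (Y k))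
    (hG : HasGaussianLaw (fun ω => (Y · ω)) P) (h0 : ∀ k, ∫ ω, Y k ω ∂P = 0) (k₀ : ι)
    (u : ι → ℝ) :
    ∫⁻ x, ENNReal.ofReal (Real.exp (∑ k, u k * x k)) ∂tiltedIncrements Y P k₀
      = ENNReal.ofReal (Real.exp (-(1 / 4) * ∑ j, ∑ k,
          affineExtension k₀ u j * affineExtension k₀ u k * Var[Y j - Y k; P])) := by
  classical
  set v : ι → ℝ := affineExtension k₀ u with hvdef
  have hind (z : ι → ℝ) : ∑ k, Set.indicator {k₀} 1 k * z k = z k₀ := by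
    simp [Set.indicator_apply, Finset.sum_ite_eq']
  have hv : ∑ k, v k = 1 := by
    have := hind 1
    simp only [Pi.one_apply, mul_one] at this
    simp only [hvdef, affineExtension]
    rw [Finset.sum_add_distrib, ← Finset.mul_sum, this]
    ring
  rw [← lintegral_exp_sum_sub_half_variance hG h0 hv, lintegral_tiltedIncrements hY k₀
    (by fun_prop)]
  refine lintegral_congr fun ω => ?_
  rw [← ENNReal.ofReal_mul (Real.exp_pos _).le, ← Real.exp_add]
  congr 2
  have h1 : ∑ k, v k * (Y k ω - Var[Y k; P] / 2)
      = (∑ k, u k * logNormalized Y P ω k) + (1 - ∑ j, u j) * logNormalized Y P ω k₀ := by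
    rw [← hind (logNormalized Y P ω), Finset.mul_sum, ← Finset.sum_add_distrib]
    refine Finset.sum_congr rfl fun k _ => ?_
    simp only [hvdef, affineExtension, logNormalized]
    ring
  rw [h1]
  simp_rw [mul_sub, Finset.sum_sub_distrib, ← Finset.sum_mul]
  ring

lemma isFiniteMeasure_tiltedIncrements {Y : ι → Ω → ℝ} (hY : ∀ k, Measurable (Y k))
    (hG : HasGaussianLaw (fun ω => (Y · ω)) P) (h0 : ∀ k, ∫ ω, Y k ω ∂P = 0) (k₀ : ι) :
    IsFiniteMeasure (tiltedIncrements Y P k₀) := by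
  -- The transform at `u = 0` is the total mass.
  have hv := lintegral_exp_tiltedIncrements hY hG h0 k₀ 0
  refine ⟨?_⟩
  simp only [Pi.zero_apply, zero_mul, Finset.sum_const_zero, Real.exp_zero, ENNReal.ofReal_one,
    lintegral_one] at hv
  rw [hv]
  exact ENNReal.ofReal_lt_top

-- Write `L k = (L k - L k₀) + L k₀`; by homogeneity the common summand comes out as the factor `exp
-- (L k₀)`, the tilting density.
omit [Fintype ι] in
lemma lintegral_expIntensity_exceedance [Countable ι] {Y : ι → Ω → ℝ}
    (hY : ∀ k, Measurable (Y k)) (k₀ : ι) (y : ι → ℝ) :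
    ∫⁻ ω, expIntensity (exceedance y (logNormalized Y P ω)) ∂P
      = ∫⁻ z, expIntensity (exceedance y z) ∂tiltedIncrements Y P k₀ := by
  rw [lintegral_tiltedIncrements hY k₀ (measurable_expIntensity_exceedance y)]
  refine lintegral_congr fun ω => ?_
  rw [← expIntensity_exceedance_add_const]
  simp

lemma tiltedIncrements_eq {Y : ι → Ω → ℝ} {Y' : ι → Ω' → ℝ}
    (hY : ∀ k, Measurable (Y k)) (hY' : ∀ k, Measurable (Y' k))
    (hG : HasGaussianLaw (fun ω => (Y · ω)) P) (hG' : HasGaussianLaw (fun ω => (Y' · ω)) P')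
    (h0 : ∀ k, ∫ ω, Y k ω ∂P = 0) (h0' : ∀ k, ∫ ω, Y' k ω ∂P' = 0)
    (hvar : ∀ j k, Var[Y j - Y k; P] = Var[Y' j - Y' k; P']) (k₀ : ι) :
    tiltedIncrements Y P k₀ = tiltedIncrements Y' P' k₀ := by
  have := isFiniteMeasure_tiltedIncrements hY hG h0 k₀
  have := isFiniteMeasure_tiltedIncrements hY' hG' h0' k₀
  refine measure_pi_ext_of_lintegral_exp_eq (fun u => ?_) fun u => ?_
  · rw [lintegral_exp_tiltedIncrements hY hG h0]
    exact ENNReal.ofReal_ne_top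
  · rw [lintegral_exp_tiltedIncrements hY hG h0, lintegral_exp_tiltedIncrements hY' hG' h0']
    simp_rw [hvar]

/-- The mean exceedance mass of a log-normalized centred Gaussian vector only depends on the
variances of its increments. -/
lemma lintegral_expIntensity_exceedance_eq {Y : ι → Ω → ℝ} {Y' : ι → Ω' → ℝ}
    (hY : ∀ k, Measurable (Y k)) (hY' : ∀ k, Measurable (Y' k))
    (hG : HasGaussianLaw (fun ω => (Y · ω)) P) (hG' : HasGaussianLaw (fun ω => (Y' · ω)) P')
    (h0 : ∀ k, ∫ ω, Y k ω ∂P = 0) (h0' : ∀ k, ∫ ω, Y' k ω ∂P' = 0)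
    (hvar : ∀ j k, Var[Y j - Y k; P] = Var[Y' j - Y' k; P']) (y : ι → ℝ) :
    ∫⁻ ω, expIntensity (exceedance y (logNormalized Y P ω)) ∂P
      = ∫⁻ ω, expIntensity (exceedance y (logNormalized Y' P' ω)) ∂P' := by
  rcases isEmpty_or_nonempty ι with hι | ⟨⟨k₀⟩⟩
  · simp [exceedance]
  rw [lintegral_expIntensity_exceedance hY k₀, lintegral_expIntensity_exceedance hY' k₀,
    tiltedIncrements_eq hY hY' hG hG' h0 h0' hvar]

end ExceedanceMass

/-! ### Finite-dimensional distribution functions determine the law. -/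

section FiniteDimensional

variable {T : Type*}

lemma measurableSet_forall_le (I : Finset T) (y : T → ℝ) :
    MeasurableSet {f : T → ℝ | ∀ t ∈ I, f t ≤ y t} := by
  have : {f : T → ℝ | ∀ t ∈ I, f t ≤ y t} = ⋂ t ∈ I, {f | f t ≤ y t} := by ext; simp
  rw [this]
  exact I.measurableSet_biInter fun t _ => measurableSet_le (measurable_pi_apply t) measurable_const

/-- Finite measures on `ℝ^T` with the same finite-dimensional distribution functions agree. -/
lemma measure_ext_of_forall_le {μ ν : Measure (T → ℝ)} [IsFiniteMeasure μ]
    (h : ∀ (I : Finset T) (y : T → ℝ),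
      μ {f | ∀ t ∈ I, f t ≤ y t} = ν {f | ∀ t ∈ I, f t ≤ y t}) : μ = ν := by
  classical
  let C : Set (Set (T → ℝ)) := {A | ∃ (I : Finset T) (y : T → ℝ), A = {f | ∀ t ∈ I, f t ≤ y t}}
  have hgen : (MeasurableSpace.pi : MeasurableSpace (T → ℝ)) = MeasurableSpace.generateFrom C := by
    refine le_antisymm (iSup_le fun t => ?_) (MeasurableSpace.generateFrom_le ?_)
    · rw [← measurable_iff_comap_le]
      refine @measurable_of_Iic ℝ (T → ℝ) _ _ _ (MeasurableSpace.generateFrom C) _ _ _ _ fun a =>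
        MeasurableSpace.measurableSet_generateFrom ⟨{t}, fun _ => a, ?_⟩
      ext f
      simp
    · rintro _ ⟨I, y, rfl⟩
      exact measurableSet_forall_le I y
  refine ext_of_generate_finite C hgen ?_ ?_ ?_
  · rintro _ ⟨I, y, rfl⟩ _ ⟨J, z, rfl⟩ -
    refine ⟨I ∪ J, fun t => if t ∈ I then (if t ∈ J then min (y t) (z t) else y t) else z t, ?_⟩
    ext f
    simp only [Set.mem_inter_iff, Set.mem_ofPred_eq, Finset.mem_union]
    grind
  · rintro _ ⟨I, y, rfl⟩
    exact h I y
  · simpa using h ∅ 0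

end FiniteDimensional

/-! ### Attainment and law of maxima over marked Poisson processes. -/

section MarkedMaxima

variable {Ω S M T : Type*} [MeasurableSpace Ω] [MeasurableSpace S] [MeasurableSpace M]
  {ξ : ℕ → Ω → S} {μ : Measure S} {P : Measure Ω} {V : ℕ → Ω → M} {κ : Measure M}

/-- The mean number of marked points whose path `g` exceeds the level `y k` at `t k` for some
`k`. -/
noncomputable def exceedanceMass {ι : Type*} (μ : Measure S) (κ : Measure M) (g : S → M → T → ℝ)
    (t : ι → T) (y : ι → ℝ) : ℝ≥0∞ :=
  ∫⁻ s, κ {m | ∃ k, y k < g s m (t k)} ∂μ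

lemma isGreatest_range_of_finite {v : ℕ → ℝ} (h : ∀ n : ℕ, ∀ᶠ i in Filter.atTop, v i ≤ -n) :
    IsGreatest (Set.range v) (⨆ i, v i) := by
  -- With `-n < v 0`, all late terms lie below `v 0`, so the maximum over an initial segment
  -- containing the index `0` is global.
  obtain ⟨n, hn⟩ := exists_nat_gt (-v 0)
  obtain ⟨N, hN⟩ := Filter.eventually_atTop.1 (h n)
  obtain ⟨j, hj, hmax⟩ := Finset.exists_max_image (Finset.range (N + 1)) v ⟨0, by simp⟩
  have hg : IsGreatest (Set.range v) (v j) := by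
    refine ⟨⟨j, rfl⟩, ?_⟩
    rintro _ ⟨i, rfl⟩
    by_cases hi : i < N + 1
    · exact hmax i (Finset.mem_range.2 hi)
    · have h1 := hN i (by omega)
      have h2 := hmax 0 (by simp)
      linarith
  rwa [show ⨆ i, v i = v j from hg.csSup_eq]

lemma measurableSet_exists_lt {ι : Type*} [Countable ι] {g : S → M → T → ℝ}
    (hg : ∀ t, Measurable fun p : S × M => g p.1 p.2 t) (t : ι → T) (y : ι → ℝ) :
    MeasurableSet {p : S × M | ∃ k, y k < g p.1 p.2 (t k)} := by
  have : {p : S × M | ∃ k, y k < g p.1 p.2 (t k)} = ⋃ k, {p | y k < g p.1 p.2 (t k)} := by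
    ext; simp
  rw [this]
  exact MeasurableSet.iUnion fun k => measurableSet_lt measurable_const (hg _)

/-- The maximum over an independently marked Poisson process is attained as soon as every level is
exceeded finitely often in the mean. -/
lemma IsPoissonPointProcess.ae_isGreatest [IsProbabilityMeasure P]
    (h : IsPoissonPointProcess ξ μ P) (hV : ∀ i, Measurable (V i)) (hκ : ∀ i, P.map (V i) = κ)
    (hind : IndepFun (fun ω i => ξ i ω) (fun ω i => V i ω) P)
    {g : S → M → T → ℝ} (hg : ∀ t, Measurable fun p : S × M => g p.1 p.2 t) (t : T)
    (hfin : ∀ y : ℝ, exceedanceMass μ κ g (fun _ : Unit => t) (fun _ => y) ≠ ∞) :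
    ∀ᵐ ω ∂P, IsGreatest (Set.range fun i => g (ξ i ω) (V i ω) t) (⨆ i, g (ξ i ω) (V i ω) t) := by
  have hae (n : ℕ) : ∀ᵐ ω ∂P, ∀ᶠ i in Filter.atTop, g (ξ i ω) (V i ω) t ≤ -n := by
    have hE := measurableSet_exists_lt hg (fun _ : Unit => t) (fun _ => -(n : ℝ))
    have hsum := h.tsum_measure_mem hV hκ hind hE
    -- Borel–Cantelli at the level `-n`.
    have := ae_eventually_notMem (hsum.trans_ne (hfin (-n)))
    filter_upwards [this] with ω hω
    filter_upwards [hω] with i hi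
    simpa using hi
  filter_upwards [ae_all_iff.2 hae] with ω hω
  exact isGreatest_range_of_finite hω

/-- The finite-dimensional distribution functions of the maximum over an independently marked
Poisson process. -/
lemma IsPoissonPointProcess.measure_iSup_le [IsProbabilityMeasure P] [IsProbabilityMeasure κ]
    (h : IsPoissonPointProcess ξ μ P) (hV : ∀ i, Measurable (V i)) (hκ : ∀ i, P.map (V i) = κ)
    (hVind : iIndepFun V P) (hind : IndepFun (fun ω i => ξ i ω) (fun ω i => V i ω) P)
    {g : S → M → T → ℝ} (hg : ∀ t, Measurable fun p : S × M => g p.1 p.2 t)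
    (hmax : ∀ t, ∀ᵐ ω ∂P,
      IsGreatest (Set.range fun i => g (ξ i ω) (V i ω) t) (⨆ i, g (ξ i ω) (V i ω) t))
    (I : Finset T) (y : T → ℝ) :
    P {ω | ∀ t ∈ I, ⨆ i, g (ξ i ω) (V i ω) t ≤ y t}
      = expNeg (exceedanceMass μ κ g (fun k : I => (k : T)) fun k => y k) := by
  rw [exceedanceMass]
  refine Eq.trans ?_ (h.measure_forall_notMem hV hκ hVind hind
    (measurableSet_exists_lt hg (fun k : I => (k : T)) fun k => y k))
  refine measure_congr ?_
  -- Attainment is essential: the real `⨆` of an unbounded family is `0`, and then a bound on it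
  -- says nothing about the terms.
  have hall : ∀ᵐ ω ∂P, ∀ k : I,
      IsGreatest (Set.range fun i => g (ξ i ω) (V i ω) k) (⨆ i, g (ξ i ω) (V i ω) k) :=
    ae_all_iff.2 fun k => hmax k
  filter_upwards [hall] with ω hω
  refine propext (?_ : (∀ t ∈ I, ⨆ i, g (ξ i ω) (V i ω) t ≤ y t)
    ↔ ∀ i, ¬ ∃ k : I, y k < g (ξ i ω) (V i ω) k)
  simp only [not_exists, not_lt]
  rw [forall_comm]
  refine ⟨fun hle k i => ((hω k).2 ⟨i, rfl⟩).trans (hle k k.2), fun hle t ht => ?_⟩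
  obtain ⟨i, hi⟩ := (hω ⟨t, ht⟩).1
  rw [← hi]
  exact hle ⟨t, ht⟩ i

end MarkedMaxima

/-! ### Generators: measurability, increments and exceedance mass. -/

section Generator

variable {d : ℕ} {Ω : Type*} [MeasurableSpace Ω] {P : Measure Ω} {γ : Rd d → ℝ}
  {W : Ω → C(Rd d, ℝ)}

lemma measurable_path_eval (t : Rd d) : Measurable fun f : C(Rd d, ℝ) => f t :=
  (measurable_pi_apply t).comp (comap_measurable fun (f : C(Rd d, ℝ)) (t : Rd d) => f t)

lemma measurable_path (s : Rd d → ℝ) (t : Rd d) :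
    Measurable fun p : ℝ × C(Rd d, ℝ) => p.1 + p.2 t - s t / 2 :=
  (measurable_fst.add ((measurable_path_eval t).comp measurable_snd)).sub_const _

/-- Continuity in the point and measurability in the path give joint measurability, needed to
evaluate paths at the random points `t - H i`. -/
lemma measurable_path_uncurry : Measurable fun p : C(Rd d, ℝ) × Rd d => p.1 p.2 :=
  (measurable_uncurry_of_continuous_of_measurable (u := fun (t : Rd d) (f : C(Rd d, ℝ)) => f t)
    (fun f => f.continuous) measurable_path_eval).comp measurable_swap

lemma IsGenerator.measurable_eval (h : IsGenerator γ W P) (t : Rd d) :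
    Measurable fun ω => W ω t := (measurable_path_eval t).comp h.measurable

lemma IsGenerator.measurable_varianceFun (h : IsGenerator γ W P) :
    Measurable (varianceFun W P) := by
  have := h.gaussian.isProbabilityMeasure
  have hv : varianceFun W P = fun t => ∫ ω, W ω t ^ 2 ∂P := funext fun t =>
    variance_of_integral_eq_zero (h.measurable_eval t).aemeasurable (h.centred t)
  rw [hv]
  have hm : Measurable fun p : Rd d × Ω => W p.2 p.1 ^ 2 :=
    (measurable_path_uncurry.comp
      ((h.measurable.comp measurable_snd).prodMk measurable_fst)).pow_const 2
  exact hm.stronglyMeasurable.integral_prod_right'.measurable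

/-- The variances of the increments of a generator are given by its variogram. -/
lemma IsGenerator.variance_sub (h : IsGenerator γ W P) (s t : Rd d) :
    Var[(fun ω => W ω s) - (fun ω => W ω t); P] = 2 * γ (s - t) := by
  have hm (s t : Rd d) : AEMeasurable (fun ω => W ω s - W ω t) P :=
    ((h.measurable_eval s).sub (h.measurable_eval t)).aemeasurable
  -- At displacement `0` the covariance of the increment field is its variance; comparing the base
  -- points `t` and `0` carries `W s - W t` to `W (s - t) - W 0`.
  have hcov := (h.intrinsic (s - t)).cov_eq 0 t 0
  simp only [zero_add, add_sub_cancel] at hcov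
  rw [covariance_self (hm _ _), covariance_self (hm _ _)] at hcov
  have hint (t : Rd d) := (h.gaussian.hasGaussianLaw_eval t).integrable
  rw [← h.variogram_eq, variogram, ← variance_of_integral_eq_zero (hm _ _), ← hcov]
  · rw [Pi.sub_def]
    ring
  · rw [integral_sub (hint _) (hint _), h.centred, h.centred, sub_zero]

lemma IsGenerator.hasGaussianLaw {ι : Type*} [Fintype ι] (h : IsGenerator γ W P) (t : ι → Rd d) :
    HasGaussianLaw (fun ω k => W ω (t k)) P := by
  classical
  -- The points `t k` may repeat: pass to the finite set of values, then recover the family by a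
  -- linear map.
  let I := Finset.univ.image t
  let L : (I → ℝ) →L[ℝ] (ι → ℝ) :=
    ContinuousLinearMap.pi fun k => ContinuousLinearMap.proj ⟨t k, by simp [I]⟩
  exact (h.gaussian.hasGaussianLaw I).map L

lemma IsGenerator.map_isProbabilityMeasure (h : IsGenerator γ W P) :
    IsProbabilityMeasure (P.map W) := by
  have := h.gaussian.isProbabilityMeasure
  exact Measure.isProbabilityMeasure_map h.measurable.aemeasurable

/-- The mean exceedance mass of the path of a generator over `e^{-x} dx`. -/
noncomputable def generatorMass {ι : Type*} (W : Ω → C(Rd d, ℝ)) (P : Measure Ω)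
    (t : ι → Rd d) (y : ι → ℝ) : ℝ≥0∞ :=
  ∫⁻ ω, expIntensity (exceedance y (logNormalized (fun k ω => W ω (t k)) P ω)) ∂P

lemma IsGenerator.lintegral_expIntensity_measure {ι : Type*} [Countable ι]
    (h : IsGenerator γ W P) (t : ι → Rd d) (y : ι → ℝ) :
    ∫⁻ x, P.map W {m | ∃ k, y k < x + m (t k) - varianceFun W P (t k) / 2} ∂expIntensity
      = generatorMass W P t y := by
  have := h.map_isProbabilityMeasure
  have hE : MeasurableSet {p : ℝ × C(Rd d, ℝ) |
      ∃ k, y k < p.1 + p.2 (t k) - varianceFun W P (t k) / 2} :=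
    measurableSet_exists_lt (T := Rd d) (g := fun (x : ℝ) (m : C(Rd d, ℝ)) t =>
      x + m t - varianceFun W P t / 2) (measurable_path _) t y
  refine (Measure.prod_apply hE).symm.trans ?_
  rw [Measure.prod_apply_symm hE, lintegral_map (measurable_measure_prodMk_right hE) h.measurable,
    generatorMass]
  refine lintegral_congr fun ω => ?_
  congr 1
  ext x
  simp only [exceedance, logNormalized, varianceFun, Set.mem_preimage, Set.mem_ofPred_eq,
    add_sub_assoc]

lemma IsGenerator.generatorMass_eq {ι Ω' : Type*} [Fintype ι] [MeasurableSpace Ω']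
    {P' : Measure Ω'} {W' : Ω' → C(Rd d, ℝ)} (h : IsGenerator γ W P) (h' : IsGenerator γ W' P')
    {t t' : ι → Rd d} (ht : ∀ j k, t j - t k = t' j - t' k) (y : ι → ℝ) :
    generatorMass W P t y = generatorMass W' P' t' y :=
  lintegral_expIntensity_exceedance_eq (fun _ => h.measurable_eval _)
    (fun _ => h'.measurable_eval _) (h.hasGaussianLaw t) (h'.hasGaussianLaw t')
    (fun _ => h.centred _) (fun _ => h'.centred _)
    (fun j k => by rw [h.variance_sub, h'.variance_sub, ht]) y

lemma IsGenerator.generatorMass_unit_ne_top (h : IsGenerator γ W P) (t : Rd d) (y : ℝ) :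
    generatorMass W P (fun _ : Unit => t) (fun _ => y) ≠ ∞ := by
  have hexc (z : Unit → ℝ) : exceedance (fun _ : Unit => y) z = Set.Ioi (y - z ()) := by
    ext x
    simpa [exceedance, sub_lt_iff_lt_add] using
      ⟨fun ⟨_, hk⟩ => hk, fun hx => ⟨(), hx⟩⟩
  simp only [generatorMass, hexc, expIntensity_Ioi, logNormalized]
  have := lintegral_exp_of_hasGaussianLaw (h.gaussian.hasGaussianLaw_eval t) (h.centred t)
    (Var[fun ω => W ω t; P] / 2 + y)
  have heq (ω : Ω) : -(y - (W ω t - Var[fun ω => W ω t; P] / 2))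
      = W ω t - (Var[fun ω => W ω t; P] / 2 + y) := by ring
  simp_rw [heq]
  rw [this]
  exact ENNReal.ofReal_ne_top

end Generator

/-! ### Exceedance masses of the plain and the shifted paths. -/

section Fields

variable {d : ℕ} {Ω₀ : Type*} [MeasurableSpace Ω₀] {P₀ : Measure Ω₀} {γ : Rd d → ℝ}
  {W : Ω₀ → C(Rd d, ℝ)}

lemma IsGenerator.exceedanceMass_path {ι : Type*} [Countable ι] (hW : IsGenerator γ W P₀)
    (t : ι → Rd d) (y : ι → ℝ) :
    exceedanceMass expIntensity (P₀.map W)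
      (fun (x : ℝ) (m : C(Rd d, ℝ)) t => x + m t - varianceFun W P₀ t / 2) t y
        = generatorMass W P₀ t y :=
  hW.lintegral_expIntensity_measure t y

lemma IsGenerator.measurable_shiftedPath (hW : IsGenerator γ W P₀) (t : Rd d) :
    Measurable fun p : (ℝ × Rd d) × C(Rd d, ℝ) =>
      p.1.1 + p.2 (t - p.1.2) - varianceFun W P₀ (t - p.1.2) / 2 := by
  have h1 : Measurable fun p : (ℝ × Rd d) × C(Rd d, ℝ) => t - p.1.2 := by fun_prop
  exact ((measurable_fst.comp measurable_fst).add
    (measurable_path_uncurry.comp (measurable_snd.prodMk h1))).sub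
      ((hW.measurable_varianceFun.comp h1).div_const 2)

/-- A random shift does not change the mean exceedance mass. -/
lemma IsGenerator.exceedanceMass_shiftedPath {ι : Type*} [Fintype ι] (hW : IsGenerator γ W P₀)
    (Q : Measure (Rd d)) [IsProbabilityMeasure Q] (t : ι → Rd d) (y : ι → ℝ) :
    exceedanceMass (expIntensity.prod Q) (P₀.map W)
      (fun (s : ℝ × Rd d) (m : C(Rd d, ℝ)) t =>
        s.1 + m (t - s.2) - varianceFun W P₀ (t - s.2) / 2) t y
        = generatorMass W P₀ t y := by
  have := hW.map_isProbabilityMeasure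
  have hm := measurable_measure_prodMk_left (ν := P₀.map W)
    (measurableSet_exists_lt (T := Rd d) (g := fun (s : ℝ × Rd d) (m : C(Rd d, ℝ)) t =>
        s.1 + m (t - s.2) - varianceFun W P₀ (t - s.2) / 2) hW.measurable_shiftedPath t y)
  -- Integrate over the level first: for each fixed shift `h` the inner integral is the generator
  -- mass at the points `t k - h`, which is free of `h`, and `Q` has mass one.
  refine (lintegral_prod_symm' _ hm).trans ?_
  have hconst (h : Rd d) : generatorMass W P₀ (fun k => t k - h) y = generatorMass W P₀ t y :=
    hW.generatorMass_eq hW (fun j k => by abel) y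
  refine (lintegral_congr fun h =>
    (hW.lintegral_expIntensity_measure (fun k => t k - h) y).trans (hconst h)).trans ?_
  simp

end Fields

end BrownResnick

/-! ### Comparison of the two maxima. -/

open BrownResnick in
theorem mainTheorem2 {d : ℕ} (γ : BrownResnick.Rd d → ℝ)
    -- the field `W`, its copies `V i`, and the marked Poisson process `∑ δ_(X i, H i)`
    {Ω₀ Ω : Type*} [MeasurableSpace Ω₀] [MeasurableSpace Ω]
    (P₀ : Measure Ω₀) [IsProbabilityMeasure P₀] (P : Measure Ω) [IsProbabilityMeasure P]
    (W : Ω₀ → C(BrownResnick.Rd d, ℝ)) (hW : BrownResnick.IsGenerator γ W P₀)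
    (V : ℕ → Ω → C(BrownResnick.Rd d, ℝ)) (hV : BrownResnick.IsIIDCopies V P W P₀)
    (Q : Measure (BrownResnick.Rd d)) [IsProbabilityMeasure Q]
    (X : ℕ → Ω → ℝ) (H : ℕ → Ω → BrownResnick.Rd d)
    (hXH : BrownResnick.IsPoissonPointProcess (fun i ω => (X i ω, H i ω))
      (BrownResnick.expIntensity.prod Q) P)
    (hXHV : IndepFun (fun ω i => (X i ω, H i ω)) (fun ω i => V i ω) P)
    -- the construction of a Brown-Resnick process `Z` with the same variogram
    {Ω₀' Ω' : Type*} [MeasurableSpace Ω₀'] [MeasurableSpace Ω']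
    (P₀' : Measure Ω₀') [IsProbabilityMeasure P₀'] (P' : Measure Ω') [IsProbabilityMeasure P']
    (W' : Ω₀' → C(BrownResnick.Rd d, ℝ)) (hW' : BrownResnick.IsGenerator γ W' P₀')
    (V' : ℕ → Ω' → C(BrownResnick.Rd d, ℝ)) (hV' : BrownResnick.IsIIDCopies V' P' W' P₀')
    (X' : ℕ → Ω' → ℝ)
    (hX' : BrownResnick.IsPoissonPointProcess X' BrownResnick.expIntensity P')
    (hXV' : IndepFun (fun ω i => X' i ω) (fun ω i => V' i ω) P') :
    -- at every `t` both suprema are almost surely (finite) maxima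
    (∀ t, ∀ᵐ ω ∂P, IsGreatest
      (Set.range fun i => BrownResnick.shiftedPath (BrownResnick.varianceFun W P₀) X H V i t ω)
      (BrownResnick.shiftedField (BrownResnick.varianceFun W P₀) X H V t ω)) ∧
    (∀ t, ∀ᵐ ω ∂P', IsGreatest
      (Set.range fun i => BrownResnick.path (BrownResnick.varianceFun W' P₀') X' V' i t ω)
      (BrownResnick.field (BrownResnick.varianceFun W' P₀') X' V' t ω)) ∧
    -- the two fields have the same law on `ℝ^(ℝ^d)`, i.e. the same finite-dimensional laws
    IdentDistrib
      (fun ω t => BrownResnick.shiftedField (BrownResnick.varianceFun W P₀) X H V t ω)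
      (fun ω t => BrownResnick.field (BrownResnick.varianceFun W' P₀') X' V' t ω) P P' := by
  have := hW.map_isProbabilityMeasure
  have := hW'.map_isProbabilityMeasure
  have hκ (i : ℕ) : P.map (V i) = P₀.map W := (hV.identDistrib i).map_eq
  have hκ' (i : ℕ) : P'.map (V' i) = P₀'.map W' := (hV'.identDistrib i).map_eq
  have hmax := fun t => hXH.ae_isGreatest hV.measurable hκ hXHV hW.measurable_shiftedPath t
    fun y => by
      rw [hW.exceedanceMass_shiftedPath Q]
      exact hW.generatorMass_unit_ne_top t y
  have hmax' := fun t => hX'.ae_isGreatest hV'.measurable hκ' hXV'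
    (measurable_path (varianceFun W' P₀')) t
    fun y => by
      rw [hW'.exceedanceMass_path]
      exact hW'.generatorMass_unit_ne_top t y
  have hm : Measurable fun ω t => shiftedField (varianceFun W P₀) X H V t ω :=
    measurable_pi_lambda _ fun t => Measurable.iSup fun i =>
      (hW.measurable_shiftedPath t).comp ((hXH.measurable i).prodMk (hV.measurable i))
  have hm' : Measurable fun ω t => field (varianceFun W' P₀') X' V' t ω :=
    measurable_pi_lambda _ fun t => Measurable.iSup fun i =>
      (measurable_path (varianceFun W' P₀') t).comp ((hX'.measurable i).prodMk (hV'.measurable i))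
  refine ⟨hmax, hmax', hm.aemeasurable, hm'.aemeasurable, ?_⟩
  have := Measure.isProbabilityMeasure_map (μ := P) hm.aemeasurable
  refine measure_ext_of_forall_le fun I y => ?_
  rw [Measure.map_apply hm (measurableSet_forall_le I y),
    Measure.map_apply hm' (measurableSet_forall_le I y)]
  refine (hXH.measure_iSup_le
    (g := fun s m t => s.1 + m (t - s.2) - varianceFun W P₀ (t - s.2) / 2) hV.measurable hκ hV.indep
    hXHV hW.measurable_shiftedPath hmax I y).trans (Eq.trans ?_ (hX'.measure_iSup_le
      (g := fun x m t => x + m t - varianceFun W' P₀' t / 2) hV'.measurable hκ' hV'.indep hXV'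
      (measurable_path (varianceFun W' P₀')) hmax' I y).symm)
  rw [hW.exceedanceMass_shiftedPath Q, hW'.exceedanceMass_path,
    hW.generatorMass_eq hW' fun _ _ => rfl]
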